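/- Let $n\ge 3$ and $m\ge 1$ be integers, let $\varepsilon_1,\dots,\varepsilon_n\in\{1,-1\}$, and let $g$ be the pseudo-Euclidean metric $g_{ij}=\delta_{ij}\varepsilon_i$ on $\mathbb{R}^n$. Let $\alpha=(\alpha_1,\dots,\alpha_n)\in\mathbb{R}^n$ satisfy $\sum_{i=1}^n\varepsilon_i\alpha_i^2=0$ and put $\xi(x)=\sum_{i=1}^n\alpha_i x_i$. Let $(F^m,g_F)$ be a non-empty Ricci-flat semi-Riemannian manifold of dimension $m$ (smooth, without boundary). For smooth ($C^\infty$) functions $f,\varphi:\mathbb{R}\to\mathbb{R}$ with $f>0$ and $\varphi$ nowhere zero, let $$\widetilde g_{f,\varphi}=\varphi(\xi)^{-2}g+f(\xi)^2g_F$$ be the metric of the warped product $(\mathbb{R}^n,\varphi(\xi)^{-2}g)\times_{f(\xi)}F^m$ on $\mathbb{R}^n\times F$, and consider the equation, linear of second order in $\varphi$, $$(n-2)f\varphi''-m\varphi f''-2m\varphi'f'=0\quad\text{on }\mathbb{R}.\qquad(\ast)$$ Then: (1) For every positive smooth function $f:\mathbb{R}\to\mathbb{R}$ there is a positive smooth function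 $\varphi:\mathbb{R}\to\mathbb{R}$ satisfying $(\ast)$; and for every nowhere vanishing smooth $\varphi:\mathbb{R}\to\mathbb{R}$ satisfying $(\ast)$, $\widetilde g_{f,\varphi}$ is a semi-Riemannian metric on $\mathbb{R}^n\times F$ and it is Ricci-flat. (2) The set of Ricci-flat semi-Riemannian metrics on $\mathbb{R}^n\times F$ of the form $\widetilde g_{f,\varphi}$, with $f,\varphi:\mathbb{R}\to\mathbb{R}$ smooth and positive and satisfying $(\ast)$, is infinite. -/

import Mathlib

open scoped Manifold ContDiff

set_option maxSynthPendingDepth 3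

noncomputable section

/-! ## Ricci curvature of a metric on an open subset of a vector space

`G : E → E →L[ℝ] E →L[ℝ] ℝ` is a field of bilinear forms on a finite dimensional real vector
space `E`, that is, a metric written in coordinates. -/

section Local

variable {E : Type*} [NormedAddCommGroup E] [NormedSpace ℝ E]

/-- The Christoffel symbols of the first kind (times two), as a trilinear form:
`(v, w, z) ↦ D_v G (w, z) + D_w G (v, z) - D_z G (v, w)`. -/
def koszulForm (G : E → E →L[ℝ] E →L[ℝ] ℝ) (x : E) : E →L[ℝ] E →L[ℝ] E →L[ℝ] ℝ :=
  fderiv ℝ G x + (fderiv ℝ G x).flip -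
    ((ContinuousLinearMap.flipₗᵢ ℝ E E ℝ).toContinuousLinearEquiv :
      (E →L[ℝ] E →L[ℝ] ℝ) →L[ℝ] (E →L[ℝ] E →L[ℝ] ℝ)) ∘L (fderiv ℝ G x).flip

/-- The Christoffel symbols of the second kind: `christoffel G x v w` is the vector `Γ_x(v, w)`
(the Levi-Civita derivative of the constant field `w` along `v`), the index being raised with the
inverse of the map `E → E*` given by `G x`. -/
def christoffel (G : E → E →L[ℝ] E →L[ℝ] ℝ) (x : E) : E →L[ℝ] E →L[ℝ] E :=
  (1 / 2 : ℝ) •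
    (ContinuousLinearMap.compL ℝ E (E →L[ℝ] ℝ) E (G x).inverse ∘L koszulForm G x)

/-- For fixed `v, w`, the endomorphism `u ↦ R(u, v) w` given by the curvature tensor:
`R(u,v)w = (D_u Γ)(v,w) - (D_v Γ)(u,w) + Γ(u, Γ(v,w)) - Γ(v, Γ(u,w))`. -/
def curvatureEnd (G : E → E →L[ℝ] E →L[ℝ] ℝ) (x v w : E) : E →L[ℝ] E :=
  ((fderiv ℝ (christoffel G) x).flip v).flip w
    - (fderiv ℝ (christoffel G) x v).flip w
    + (christoffel G x).flip (christoffel G x v w)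
    - christoffel G x v ∘L (christoffel G x).flip w

/-- The Ricci curvature in coordinates: `Ric(v, w)` is the trace of `u ↦ R(u, v) w`. -/
def coordRicci (G : E → E →L[ℝ] E →L[ℝ] ℝ) (x v w : E) : ℝ :=
  LinearMap.trace ℝ E (curvatureEnd G x v w : E →ₗ[ℝ] E)

end Local

/-! ## Semi-Riemannian metrics on manifolds -/

section Manifolds

variable {E : Type*} [NormedAddCommGroup E] [NormedSpace ℝ E]
  {H : Type*} [TopologicalSpace H] (I : ModelWithCorners ℝ E H)
  (M : Type*) [TopologicalSpace M] [ChartedSpace H M]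
  {E' : Type*} [NormedAddCommGroup E'] [NormedSpace ℝ E']
  {H' : Type*} [TopologicalSpace H'] (J : ModelWithCorners ℝ E' H')
  (N : Type*) [TopologicalSpace N] [ChartedSpace H' N]

/-- A field of bilinear forms on the tangent spaces of `M`, with no condition. -/
abbrev BilinField : Type _ :=
  ∀ x : M, TangentSpace I x →L[ℝ] TangentSpace I x →L[ℝ] ℝ

variable {M N}

/-- The pullback `(u^* g)_x (v, w) = g_{u x} (du v, du w)`. -/
def bilinPullback (u : M → N) (g : BilinField J N) : BilinField I M := fun x =>
  (ContinuousLinearMap.precomp ℝ (mfderiv I J u x)) ∘L (g (u x)) ∘L (mfderiv I J u x)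

/-- The expression of `g` in a chart `e`: the pullback of `g` by the inverse of the chart. It is
meaningful on the target of the chart. -/
def coordMetric (g : BilinField I M) (e : OpenPartialHomeomorph M H) :
    E → E →L[ℝ] E →L[ℝ] ℝ :=
  bilinPullback 𝓘(ℝ, E) I (e.extend I).symm g

/-- `g` is a semi-Riemannian metric: symmetric, nondegenerate at every point, and smooth, i.e. its
expression in every chart of the atlas is `C^∞`. -/
structure IsSemiRiemannianMetric [I.Boundaryless] (g : BilinField I M) : Prop where
  symm : ∀ (x : M) (v w : TangentSpace I x), g x v w = g x w v
  nondegenerate : ∀ (x : M) (v : TangentSpace I x), (∀ w : TangentSpace I x, g x v w = 0) → v = 0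
  smooth : ∀ e ∈ atlas H M, ContDiffOn ℝ ∞ (coordMetric I g e) (e.extend I).target

/-- `g` is Ricci-flat: its Ricci tensor vanishes at every point, computed in any chart of the
atlas around this point. -/
def IsRicciFlat [I.Boundaryless] (g : BilinField I M) : Prop :=
  ∀ e ∈ atlas H M, ∀ y ∈ (e.extend I).target, ∀ v w : E, coordRicci (coordMetric I g e) y v w = 0

/-- The warped product metric `π_B^* g_B + (f ∘ π_B)^2 π_F^* g_F` on the product manifold
`B × F` (here `B = M` and `F = N`). -/
def warpedProduct (gB : BilinField I M) (f : M → ℝ) (gF : BilinField J N) :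
    BilinField (I.prod J) (M × N) := fun p =>
  bilinPullback (I.prod J) I Prod.fst gB p
    + (f p.1) ^ 2 • bilinPullback (I.prod J) J Prod.snd gF p

end Manifolds

/-! ## The base `(ℝ^n, φ^{-2} g)` -/

/-- The bilinear form `(v, w) ↦ ∑ ε_i v_i w_i` on `ℝ^n`. -/
def pseudoEuclideanForm {n : ℕ} (ε : Fin n → ℝ) :
    EuclideanSpace ℝ (Fin n) →L[ℝ] EuclideanSpace ℝ (Fin n) →L[ℝ] ℝ :=
  ∑ i, ε i • ContinuousLinearMap.smulRight (EuclideanSpace.proj (𝕜 := ℝ) i)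
    (EuclideanSpace.proj (𝕜 := ℝ) i : EuclideanSpace ℝ (Fin n) →L[ℝ] ℝ)

/-- The pseudo-Euclidean metric `g_{ij} = δ_{ij} ε_i` on `ℝ^n`. -/
def pseudoEuclidean {n : ℕ} (ε : Fin n → ℝ) : BilinField (𝓡 n) (EuclideanSpace ℝ (Fin n)) :=
  fun _ => pseudoEuclideanForm ε

/-- The linear function `ξ = ∑ α_i x_i` on `ℝ^n`. -/
def xiFun {n : ℕ} (α : Fin n → ℝ) (x : EuclideanSpace ℝ (Fin n)) : ℝ := ∑ i, α i * x i

/-- The conformal metric `φ^{-2} g` on `ℝ^n`. -/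
def conformalMetric {n : ℕ} (ε : Fin n → ℝ) (φ : EuclideanSpace ℝ (Fin n) → ℝ) :
    BilinField (𝓡 n) (EuclideanSpace ℝ (Fin n)) :=
  fun x => (φ x ^ 2)⁻¹ • pseudoEuclidean ε x

/-- The metric `φ(ξ)^{-2} g + f(ξ)^2 g_F` of the warped product `(ℝ^n, φ(ξ)^{-2} g) ×_{f(ξ)} F`. -/
def warpedXiMetric {n m : ℕ} (ε α : Fin n → ℝ) {F : Type*} [TopologicalSpace F]
    [ChartedSpace (EuclideanSpace ℝ (Fin m)) F] (gF : BilinField (𝓡 m) F) (f φ : ℝ → ℝ) :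
    BilinField ((𝓡 n).prod (𝓡 m)) (EuclideanSpace ℝ (Fin n) × F) :=
  warpedProduct (𝓡 n) (𝓡 m) (conformalMetric ε (fun x => φ (xiFun α x)))
    (fun x => f (xiFun α x)) gF

/-- The linear second order equation `(n-2) f φ'' - m φ f'' - 2 m φ' f' = 0` on `ℝ`. -/
def WarpingODE (n m : ℕ) (f φ : ℝ → ℝ) : Prop :=
  ∀ t : ℝ, ((n : ℝ) - 2) * f t * deriv (deriv φ) t - (m : ℝ) * φ t * deriv (deriv f) t
    - 2 * (m : ℝ) * deriv φ t * deriv f t = 0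

end

/-! ## The linear equation -/

section LinearODE

open MeasureTheory Set

/-! Write the metric as `a(ξ) g + b(ξ) h` with `a = φ⁻²`, `b = f²`, and let `A` be the `g`-gradient
of `ξ`. The hypothesis on `α` says that `A` is null, `ξ A = 0`, so every curvature term carrying the
square of the gradient disappears. The Ricci tensor is then that of the fibre plus one scalar times
`ξ ⊗ ξ` (`coordRicci_warpedForm`). With `p = -φ'/φ` and `q = f'/f` this scalar is the left side of
the linear equation divided by `f φ`, so a solution over a Ricci-flat fibre gives a Ricci-flat
metric. Charts of the product have the form `id × e`, which carries the computation over to the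
manifold (`coordMetric_warpedXiMetric`).

For existence, `φ = f ^ c ψ` removes the first order term and leaves `ψ'' = Q ψ` with `Q ≥ 0`. The
Picard series of this equation converges on the whole line and has nonnegative terms starting with
`1`, so `ψ ≥ 1` and positivity is global (`exists_pos_solution_of_nonneg`).

For infinitude, the equation is homogeneous in `f`: scaling `f` by `c > 0` keeps `φ` a solution and
changes the metric on fibre vectors. -/

theorem abs_intervalIntegral_le_of_le_pow {h : ℝ → ℝ} {C T : ℝ} {k : ℕ}
    (hh : ∀ s, |s| ≤ T → |h s| ≤ C * |s| ^ k) {t : ℝ} (ht : |t| ≤ T) :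
    |∫ s in (0 : ℝ)..t, h s| ≤ C * (|t| ^ (k + 1) / (k + 1)) := by
  have key : ∀ (h : ℝ → ℝ) (t : ℝ), 0 ≤ t → t ≤ T → (∀ s, |s| ≤ T → |h s| ≤ C * |s| ^ k) →
      |∫ s in (0 : ℝ)..t, h s| ≤ C * (|t| ^ (k + 1) / (k + 1)) := by
    intro h t h0 hT hh
    have h1 : ‖∫ s in (0 : ℝ)..t, h s‖ ≤ ∫ s in (0 : ℝ)..t, C * s ^ k := by
      refine intervalIntegral.norm_integral_le_of_norm_le h0 (.of_forall fun s hs => ?_)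
        (Continuous.intervalIntegrable (by fun_prop) _ _)
      have := hh s (by rw [abs_of_pos hs.1]; exact hs.2.trans hT)
      rwa [abs_of_pos hs.1] at this
    rw [Real.norm_eq_abs] at h1
    refine h1.trans_eq ?_
    rw [intervalIntegral.integral_const_mul, integral_pow, abs_of_nonneg h0]
    simp
  rcases le_total 0 t with h0 | h0
  · exact key h t h0 (by rwa [abs_of_nonneg h0] at ht) hh
  · have := key (fun s => h (-s)) (-t) (by linarith) (by rwa [abs_of_nonpos h0] at ht)
      (fun s hs => by simpa using hh (-s) (by simpa using hs))
    rw [intervalIntegral.integral_comp_neg] at this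
    rw [intervalIntegral.integral_symm]
    simpa using this

/-- The terms of the Picard series of `ψ'' = q ψ`, `ψ(0) = 1`, `ψ'(0) = 0`. -/
noncomputable def picardTerm (q : ℝ → ℝ) : ℕ → ℝ → ℝ
  | 0 => fun _ => 1
  | k + 1 => fun t => ∫ s in (0 : ℝ)..t, ∫ r in (0 : ℝ)..s, q r * picardTerm q k r

/-- The derivatives of the terms of the Picard series. -/
noncomputable def picardTermDeriv (q : ℝ → ℝ) : ℕ → ℝ → ℝ
  | 0 => fun _ => 0
  | k + 1 => fun t => ∫ r in (0 : ℝ)..t, q r * picardTerm q k r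

/-- The second derivatives of the terms of the Picard series. -/
noncomputable def picardTermDerivTwo (q : ℝ → ℝ) : ℕ → ℝ → ℝ
  | 0 => fun _ => 0
  | k + 1 => fun t => q t * picardTerm q k t

variable {q : ℝ → ℝ}

theorem hasDerivAt_primitive {h : ℝ → ℝ} (hh : Continuous h) (t : ℝ) :
    HasDerivAt (fun t => ∫ s in (0 : ℝ)..t, h s) (h t) t :=
  intervalIntegral.integral_hasDerivAt_right (hh.intervalIntegrable _ _)
    hh.stronglyMeasurable.stronglyMeasurableAtFilter hh.continuousAt

theorem continuous_primitive_zero {h : ℝ → ℝ} (hh : Continuous h) :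
    Continuous (fun t => ∫ s in (0 : ℝ)..t, h s) :=
  continuous_iff_continuousAt.2 fun t => (hasDerivAt_primitive hh t).continuousAt

theorem continuous_picardTerm (hq : Continuous q) : ∀ k, Continuous (picardTerm q k)
  | 0 => continuous_const
  | k + 1 => continuous_primitive_zero
      (continuous_primitive_zero (hq.mul (continuous_picardTerm hq k)))

theorem hasDerivAt_picardTerm (hq : Continuous q) : ∀ k t,
    HasDerivAt (picardTerm q k) (picardTermDeriv q k t) t
  | 0, t => hasDerivAt_const t 1
  | k + 1, t => hasDerivAt_primitive
      (continuous_primitive_zero (hq.mul (continuous_picardTerm hq k))) t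

theorem hasDerivAt_picardTermDeriv (hq : Continuous q) : ∀ k t,
    HasDerivAt (picardTermDeriv q k) (picardTermDerivTwo q k t) t
  | 0, t => hasDerivAt_const t 0
  | k + 1, t => hasDerivAt_primitive (hq.mul (continuous_picardTerm hq k)) t

theorem picardTerm_nonneg (hq0 : ∀ t, 0 ≤ q t) : ∀ k t, 0 ≤ picardTerm q k t := by
  intro k
  induction k with
  | zero => intro t; exact zero_le_one
  | succ k ih =>
    intro t
    have hnn : ∀ r, 0 ≤ q r * picardTerm q k r := fun r => mul_nonneg (hq0 r) (ih r)
    change 0 ≤ ∫ s in (0 : ℝ)..t, ∫ r in (0 : ℝ)..s, q r * picardTerm q k r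
    rcases le_total 0 t with h0 | h0
    · exact intervalIntegral.integral_nonneg h0 fun s hs =>
        intervalIntegral.integral_nonneg hs.1 fun r _ => hnn r
    -- For `t ≤ 0` both integrals run backwards, and the two signs cancel.
    · rw [intervalIntegral.integral_symm, ← intervalIntegral.integral_neg]
      refine intervalIntegral.integral_nonneg h0 fun s hs => ?_
      rw [← intervalIntegral.integral_symm]
      exact intervalIntegral.integral_nonneg hs.2 fun r _ => hnn r

/-- Each Picard step integrates twice, whence `(2k)!`. The two bounds go through one induction
because the next term is the integral of the derivative bounded here. -/
theorem abs_picardTerm_le {T M : ℝ} (hM : 0 ≤ M) (hqM : ∀ t, |t| ≤ T → |q t| ≤ M) :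
    ∀ k t, |t| ≤ T → |picardTerm q k t| ≤ M ^ k / (2 * k).factorial * |t| ^ (2 * k) ∧
      |picardTermDeriv q (k + 1) t| ≤
        M ^ (k + 1) / (2 * k + 1).factorial * |t| ^ (2 * k + 1) := by
  intro k
  induction k with
  | zero =>
    intro t ht
    refine ⟨by simp [picardTerm], ?_⟩
    have := abs_intervalIntegral_le_of_le_pow (h := fun r => q r * picardTerm q 0 r) (C := M)
      (T := T) (k := 0) (fun s hs => by simpa [picardTerm] using hqM s hs) ht
    simpa [picardTermDeriv] using this
  | succ k ih =>
    have h1 : ∀ t, |t| ≤ T → |picardTerm q (k + 1) t| ≤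
        M ^ (k + 1) / (2 * (k + 1)).factorial * |t| ^ (2 * (k + 1)) := by
      intro t ht
      have := abs_intervalIntegral_le_of_le_pow (h := picardTermDeriv q (k + 1)) (T := T)
        (fun s hs => (ih s hs).2) ht
      refine this.trans_eq ?_
      rw [show 2 * (k + 1) = 2 * k + 1 + 1 by ring, Nat.factorial_succ (2 * k + 1)]
      push_cast
      field_simp
    intro t ht
    refine ⟨h1 t ht, ?_⟩
    have := abs_intervalIntegral_le_of_le_pow (h := fun r => q r * picardTerm q (k + 1) r)
      (C := M * (M ^ (k + 1) / (2 * (k + 1)).factorial)) (T := T) (k := 2 * (k + 1))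
      (fun s hs => by
        rw [abs_mul, mul_assoc]
        exact mul_le_mul (hqM s hs) (h1 s hs) (abs_nonneg _) hM) ht
    refine this.trans_eq ?_
    rw [Nat.factorial_succ (2 * (k + 1))]
    push_cast
    field_simp
    ring

/-- These are the even terms of the exponential series at `√M T`; the odd ones, times `√M`, give the
next lemma. -/
theorem summable_pow_div_factorial_two_mul {M T : ℝ} (hM : 0 ≤ M) :
    Summable fun k : ℕ => M ^ k / (2 * k).factorial * T ^ (2 * k) := by
  have h := (Real.summable_pow_div_factorial (Real.sqrt M * T)).comp_injective
    (mul_right_injective₀ (two_ne_zero (α := ℕ)))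
  refine h.congr fun k => ?_
  simp only [Function.comp_apply]
  rw [mul_pow, pow_mul, Real.sq_sqrt hM]
  ring

theorem summable_pow_div_factorial_two_mul_add_one {M T : ℝ} (hM : 0 ≤ M) :
    Summable fun k : ℕ => M ^ (k + 1) / (2 * k + 1).factorial * T ^ (2 * k + 1) := by
  have h := ((Real.summable_pow_div_factorial (Real.sqrt M * T)).comp_injective
    ((add_left_injective 1).comp (mul_right_injective₀ (two_ne_zero (α := ℕ))))).mul_left
      (Real.sqrt M)
  refine h.congr fun k => ?_
  simp only [Function.comp_apply]
  have : M ^ (k + 1) = Real.sqrt M * Real.sqrt M ^ (2 * k + 1) := by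
    rw [← pow_succ', show 2 * k + 1 + 1 = 2 * (k + 1) by ring, pow_mul, Real.sq_sqrt hM]
  rw [this, mul_pow]
  ring

/-- The equation `ψ'' = q ψ` with `q ≥ 0` smooth has a smooth positive solution on the line. -/
theorem exists_pos_solution_of_nonneg (hq : ContDiff ℝ ∞ q) (hq0 : ∀ t, 0 ≤ q t) :
    ∃ ψ : ℝ → ℝ, ContDiff ℝ ∞ ψ ∧ (∀ t, 0 < ψ t) ∧ ∀ t, deriv (deriv ψ) t = q t * ψ t := by
  have hqc := hq.continuous
  have hbound : ∀ T : ℝ, ∃ M, 0 ≤ M ∧ ∀ t, |t| ≤ T → |q t| ≤ M := by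
    intro T
    obtain ⟨M, hM⟩ := (isCompact_Icc (a := -T) (b := T)).exists_bound_of_continuousOn
      hqc.continuousOn
    exact ⟨max M 0, le_max_right _ _, fun t ht => (hM t (abs_le.1 ht)).trans (le_max_left _ _)⟩
  have hsum : ∀ t, Summable fun k => picardTerm q k t := by
    intro t
    obtain ⟨M, hM0, hM⟩ := hbound |t|
    exact .of_norm_bounded (summable_pow_div_factorial_two_mul (T := |t|) hM0)
      fun k => (abs_picardTerm_le hM0 hM k t le_rfl).1
  have hsum' : ∀ t, Summable fun k => picardTermDeriv q k t := by
    intro t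
    obtain ⟨M, hM0, hM⟩ := hbound |t|
    rw [← summable_nat_add_iff 1]
    exact .of_norm_bounded (summable_pow_div_factorial_two_mul_add_one (T := |t|) hM0)
      fun k => (abs_picardTerm_le hM0 hM k t le_rfl).2
  have hball : ∀ {T t : ℝ}, t ∈ Metric.ball (0 : ℝ) T → |t| ≤ T := fun h => by
    simpa using (Metric.mem_ball.1 h).le
  have hd1 : ∀ t, HasDerivAt (fun t => ∑' k, picardTerm q k t) (∑' k, picardTermDeriv q k t) t := by
    intro t
    obtain ⟨M, hM0, hM⟩ := hbound (|t| + 1)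
    have hT : (0 : ℝ) ≤ |t| + 1 := by positivity
    refine hasDerivAt_tsum_of_isPreconnected (t := Metric.ball 0 (|t| + 1)) (y₀ := 0)
      -- The bound on derivatives is indexed from `k + 1`; the term of index `0` is constant and has
      -- derivative `0`.
      (u := fun k => if k = 0 then 0 else
        M ^ (k - 1 + 1) / (2 * (k - 1) + 1).factorial * (|t| + 1) ^ (2 * (k - 1) + 1))
      ?_ Metric.isOpen_ball (convex_ball _ _).isPreconnected
      (fun k y _ => hasDerivAt_picardTerm hqc k y) ?_ (Metric.mem_ball_self (by positivity))
      (hsum 0) (by simp)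
    · rw [← summable_nat_add_iff 1]
      simpa using summable_pow_div_factorial_two_mul_add_one (T := |t| + 1) hM0
    · rintro (_ | k) y hy
      · simp [picardTermDeriv]
      · simp only [Nat.succ_ne_zero, if_false, Nat.add_sub_cancel]
        refine (abs_picardTerm_le hM0 hM k y (hball hy)).2.trans ?_
        have := hball hy
        gcongr
  have hd2 : ∀ t, HasDerivAt (fun t => ∑' k, picardTermDeriv q k t)
      (∑' k, picardTermDerivTwo q k t) t := by
    intro t
    obtain ⟨M, hM0, hM⟩ := hbound (|t| + 1)
    have hT : (0 : ℝ) ≤ |t| + 1 := by positivity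
    refine hasDerivAt_tsum_of_isPreconnected (t := Metric.ball 0 (|t| + 1)) (y₀ := 0)
      (u := fun k => if k = 0 then 0 else
        M * (M ^ (k - 1) / (2 * (k - 1)).factorial * (|t| + 1) ^ (2 * (k - 1))))
      ?_ Metric.isOpen_ball (convex_ball _ _).isPreconnected
      (fun k y _ => hasDerivAt_picardTermDeriv hqc k y) ?_ (Metric.mem_ball_self (by positivity))
      (hsum' 0) (by simp)
    · rw [← summable_nat_add_iff 1]
      simpa using (summable_pow_div_factorial_two_mul (T := |t| + 1) hM0).mul_left M
    · rintro (_ | k) y hy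
      · simp [picardTermDerivTwo]
      · simp only [Nat.succ_ne_zero, if_false, Nat.add_sub_cancel]
        simp only [picardTermDerivTwo, Real.norm_eq_abs]
        rw [abs_mul]
        have hy' := hball hy
        refine mul_le_mul (hM y hy') ((abs_picardTerm_le hM0 hM k y hy').1.trans ?_)
          (abs_nonneg _) hM0
        gcongr
  -- Shifting the index by one turns the series of second derivatives into `q` times the original
  -- series.
  have htwo : ∀ t, ∑' k, picardTermDerivTwo q k t = q t * ∑' k, picardTerm q k t := by
    intro t
    have h : Summable fun k => picardTermDerivTwo q k t := by
      rw [← summable_nat_add_iff 1]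
      exact (hsum t).mul_left (q t)
    rw [h.tsum_eq_zero_add, ← tsum_mul_left]
    simp [picardTermDerivTwo]
  set ψ : ℝ → ℝ := fun t => ∑' k, picardTerm q k t with hψ
  have e1 : deriv ψ = fun t => ∑' k, picardTermDeriv q k t := funext fun t => (hd1 t).deriv
  have e2 : deriv (deriv ψ) = fun t => q t * ψ t := by
    rw [e1]; exact funext fun t => (hd2 t).deriv.trans (htwo t)
  have hdiff1 : Differentiable ℝ ψ := fun t => (hd1 t).differentiableAt
  have hdiff2 : Differentiable ℝ (deriv ψ) := by
    rw [e1]; exact fun t => (hd2 t).differentiableAt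
  refine ⟨ψ, ?_, fun t => ?_, fun t => congrFun e2 t⟩
  -- Bootstrap: if `ψ` is `C^n`, so is `ψ'' = q ψ`, hence `ψ` gains regularity.
  · rw [contDiff_infty]
    intro n
    induction n with
    | zero => exact contDiff_zero.2 hdiff1.continuous
    | succ n ih =>
      have h2 : ContDiff ℝ n (deriv (deriv ψ)) := by
        rw [e2]; exact (hq.of_le (by exact_mod_cast le_top)).mul ih
      have h1 : ContDiff ℝ (n + 1 : ℕ) (deriv ψ) := by
        push_cast; exact contDiff_succ_iff_deriv.2 ⟨hdiff2, by simp, h2⟩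
      push_cast
      exact contDiff_succ_iff_deriv.2 ⟨hdiff1, by simp, h1.of_le (by simp)⟩
  · have := (hsum t).le_tsum 0 fun k _ => picardTerm_nonneg hq0 k t
    exact zero_lt_one.trans_le this

/-- For `f > 0` the equation `(n - 2) f φ'' - m φ f'' - 2 m φ' f' = 0` has a positive smooth
solution `φ`. The substitution `φ = f ^ c ψ` with `c = m / (n - 2)` reduces it to
`ψ'' = c (c + 1) (f' / f) ^ 2 ψ`. -/
theorem exists_pos_warpingODE {n m : ℕ} (hn : 3 ≤ n) {f : ℝ → ℝ} (hf : ContDiff ℝ ∞ f)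
    (hpos : ∀ t, 0 < f t) :
    ∃ φ : ℝ → ℝ, ContDiff ℝ ∞ φ ∧ (∀ t, 0 < φ t) ∧ WarpingODE n m f φ := by
  have hn' : (0 : ℝ) < (n : ℝ) - 2 := by
    have : (3 : ℝ) ≤ n := by exact_mod_cast hn
    linarith
  -- For this exponent the terms in `ψ'` and in `f''` both cancel; `c ≥ 0` makes the remaining
  -- coefficient nonnegative whatever `f` is.
  set c : ℝ := m / ((n : ℝ) - 2) with hc
  have hc0 : 0 ≤ c := by positivity
  have hmc : (m : ℝ) = c * ((n : ℝ) - 2) := by rw [hc]; field_simp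
  have hne : ∀ t, f t ≠ 0 := fun t => (hpos t).ne'
  have hf' : ContDiff ℝ ∞ (deriv f) := (contDiff_infty_iff_deriv.1 hf).2
  have hfd : ∀ t, HasDerivAt f (deriv f t) t := fun t =>
    ((contDiff_infty_iff_deriv.1 hf).1 t).hasDerivAt
  have hfd' : ∀ t, HasDerivAt (deriv f) (deriv (deriv f) t) t := fun t =>
    ((contDiff_infty_iff_deriv.1 hf').1 t).hasDerivAt
  obtain ⟨ψ, hψ, hψpos, hψeq⟩ := exists_pos_solution_of_nonneg
    (q := fun t => c * (c + 1) * (deriv f t / f t) ^ 2)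
    (contDiff_const.mul ((hf'.div hf hne).pow 2)) (fun t => by positivity)
  have hψ' : ContDiff ℝ ∞ (deriv ψ) := (contDiff_infty_iff_deriv.1 hψ).2
  have hψd : ∀ t, HasDerivAt ψ (deriv ψ t) t := fun t =>
    ((contDiff_infty_iff_deriv.1 hψ).1 t).hasDerivAt
  have hψd' : ∀ t, HasDerivAt (deriv ψ) (deriv (deriv ψ) t) t := fun t =>
    ((contDiff_infty_iff_deriv.1 hψ').1 t).hasDerivAt
  set P : ℝ → ℝ := fun t => f t ^ c with hP
  have hPd : ∀ t, HasDerivAt P (c * (deriv f t / f t) * P t) t := by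
    intro t
    refine ((hfd t).rpow_const (p := c) (Or.inl (hne t))).congr_deriv ?_
    rw [Real.rpow_sub_one (hne t)]
    simp only [hP]
    ring
  refine ⟨fun t => P t * ψ t, (hf.rpow_const_of_ne hne).mul hψ,
    fun t => mul_pos (Real.rpow_pos_of_pos (hpos t) c) (hψpos t), fun t => ?_⟩
  have d1 : deriv (fun t => P t * ψ t) =
      fun t => c * (deriv f t / f t) * P t * ψ t + P t * deriv ψ t :=
    funext fun t => ((hPd t).mul (hψd t)).deriv
  have d2 := (((((hfd' t).div (hfd t) (hne t)).const_mul c).mul (hPd t)).mul (hψd t)).add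
    ((hPd t).mul (hψd' t))
  rw [d1]
  erw [d2.deriv]
  rw [hψeq, hmc]
  have := hne t
  simp only [Pi.mul_apply, Pi.div_apply]
  field_simp
  ring

end LinearODE

theorem fderiv_apply_apply {E : Type*} [NormedAddCommGroup E] [NormedSpace ℝ E]
    {V W X : Type*} [NormedAddCommGroup V] [NormedSpace ℝ V] [NormedAddCommGroup W]
    [NormedSpace ℝ W] [NormedAddCommGroup X] [NormedSpace ℝ X]
    {G : E → V →L[ℝ] W →L[ℝ] X} {x : E} (hG : DifferentiableAt ℝ G x) (v : V) (w : W) (u : E) :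
    fderiv ℝ (fun y => G y v w) x u = fderiv ℝ G x u v w := by
  rw [((hG.hasFDerivAt.clm_apply (hasFDerivAt_const v x)).clm_apply
    (hasFDerivAt_const w x)).fderiv]
  simp

/-! ## Curvature in coordinates -/

section Coordinates

variable {E : Type*} [NormedAddCommGroup E] [NormedSpace ℝ E]
  {G : E → E →L[ℝ] E →L[ℝ] ℝ} {x : E}

theorem koszulForm_apply (G : E → E →L[ℝ] E →L[ℝ] ℝ) (x v w z : E) :
    koszulForm G x v w z = fderiv ℝ G x v w z + fderiv ℝ G x w v z - fderiv ℝ G x z v w := rfl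

theorem christoffel_apply (G : E → E →L[ℝ] E →L[ℝ] ℝ) (x v w : E) :
    christoffel G x v w = (1 / 2 : ℝ) • (G x).inverse (koszulForm G x v w) := rfl

/-- `christoffel` raises an index with `ContinuousLinearMap.inverse`, which takes the default value
`0` at non-invertible maps; nondegeneracy rules this out. -/
theorem isInvertible_of_nondegenerate [FiniteDimensional ℝ E] {B : E →L[ℝ] E →L[ℝ] ℝ}
    (hB : ∀ v, (∀ w, B v w = 0) → v = 0) : B.IsInvertible := by
  have hinj : Function.Injective (B : E →ₗ[ℝ] E →L[ℝ] ℝ) := by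
    rw [injective_iff_map_eq_zero]
    exact fun v hv => hB v fun w => by
      simpa using congrArg (fun l : E →L[ℝ] ℝ => l w) hv
  have hrank : Module.finrank ℝ E = Module.finrank ℝ (E →L[ℝ] ℝ) := by
    rw [← (LinearMap.toContinuousLinearMap (𝕜 := ℝ) (E := E) (F' := ℝ)).finrank_eq]
    exact (Subspace.dual_finrank_eq (K := ℝ) (V := E)).symm
  refine ⟨(LinearEquiv.ofInjectiveOfFinrankEq (B : E →ₗ[ℝ] E →L[ℝ] ℝ) hinj
    hrank).toContinuousLinearEquiv, ?_⟩
  ext v w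
  rfl

theorem two_mul_apply_christoffel (h : (G x).IsInvertible) (v w z : E) :
    2 * G x (christoffel G x v w) z = koszulForm G x v w z := by
  rw [christoffel_apply, map_smul, h.self_apply_inverse]
  simp

/-- The Koszul identity determines the Christoffel vector, so a candidate can be checked by pairing,
without computing an inverse metric. -/
theorem christoffel_eq_of_forall (h : (G x).IsInvertible) {v w c : E}
    (hc : ∀ z, 2 * G x c z = koszulForm G x v w z) : christoffel G x v w = c := by
  refine h.injective (ContinuousLinearMap.ext fun z => ?_)
  have := two_mul_apply_christoffel h v w z
  have := hc z
  linarith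

theorem differentiableAt_christoffel [CompleteSpace E] (hG : ContDiffAt ℝ 2 G x)
    (h : (G x).IsInvertible) : DifferentiableAt ℝ (christoffel G) x := by
  have h1 : DifferentiableAt ℝ (fderiv ℝ G) x :=
    (hG.fderiv_right (m := 1) (by norm_num)).differentiableAt one_ne_zero
  have h2 : DifferentiableAt ℝ (fun y => (G y).inverse) x :=
    DifferentiableAt.comp x ((h.contDiffAt_map_inverse (n := 1)).differentiableAt one_ne_zero)
      (hG.differentiableAt two_ne_zero)
  have h3 : DifferentiableAt ℝ (fun y => (fderiv ℝ G y).flip) x :=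
    (ContinuousLinearMap.flipₗᵢ ℝ E E (E →L[ℝ] ℝ)).toContinuousLinearEquiv.differentiableAt.comp
      x h1
  have h4 : DifferentiableAt ℝ (koszulForm G) x :=
    (h1.add h3).sub (DifferentiableAt.clm_comp (differentiableAt_const _) h3)
  exact (DifferentiableAt.clm_comp
    ((ContinuousLinearMap.compL ℝ E (E →L[ℝ] ℝ) E).differentiableAt.comp x h2) h4).const_smul
      (1 / 2 : ℝ)

theorem curvatureEnd_apply (hd : DifferentiableAt ℝ (christoffel G) x) (u v w : E) :
    curvatureEnd G x v w u =
      fderiv ℝ (fun y => christoffel G y v w) x u - fderiv ℝ (fun y => christoffel G y u w) x v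
        + christoffel G x u (christoffel G x v w) - christoffel G x v (christoffel G x u w) := by
  rw [fderiv_apply_apply hd, fderiv_apply_apply hd]
  rfl

theorem christoffel_eventuallyEq {G' : E → E →L[ℝ] E →L[ℝ] ℝ} (h : G =ᶠ[nhds x] G') :
    christoffel G =ᶠ[nhds x] christoffel G' := by
  filter_upwards [Filter.EventuallyEq.eventuallyEq_nhds h] with y hy
  unfold christoffel koszulForm
  rw [hy.fderiv_eq, hy.eq_of_nhds]

/-- Ricci curvature depends only on the germ of the metric, so formulas valid on a chart target
suffice. -/
theorem coordRicci_congr {G' : E → E →L[ℝ] E →L[ℝ] ℝ} (h : G =ᶠ[nhds x] G') (v w : E) :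
    coordRicci G x v w = coordRicci G' x v w := by
  unfold coordRicci curvatureEnd
  rw [(christoffel_eventuallyEq h).fderiv_eq, (christoffel_eventuallyEq h).eq_of_nhds]

theorem fderiv_symm_of_eventually (hG : DifferentiableAt ℝ G x)
    (hs : ∀ᶠ y in nhds x, ∀ v w, G y v w = G y w v) (u v w : E) :
    fderiv ℝ G x u v w = fderiv ℝ G x u w v := by
  rw [← fderiv_apply_apply hG, ← fderiv_apply_apply hG]
  have : (fun y => G y v w) =ᶠ[nhds x] fun y => G y w v := hs.mono fun y hy => hy v w
  rw [this.fderiv_eq]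

theorem christoffel_symm (hG : DifferentiableAt ℝ G x)
    (hs : ∀ᶠ y in nhds x, ∀ v w, G y v w = G y w v) (v w : E) :
    christoffel G x v w = christoffel G x w v := by
  rw [christoffel_apply, christoffel_apply]
  congr 2
  ext z
  rw [koszulForm_apply, koszulForm_apply, fderiv_symm_of_eventually hG hs z v w]
  ring

end Coordinates

/-! ### Traces on a product space -/

section Trace

variable {E₁ E₂ : Type*} [AddCommGroup E₁] [Module ℝ E₁] [FiniteDimensional ℝ E₁]
  [AddCommGroup E₂] [Module ℝ E₂] [FiniteDimensional ℝ E₂]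

/-- Cyclicity of the trace moves the inclusions to the left, and `inl ∘ fst + inr ∘ snd` is the
identity. -/
theorem trace_prod_eq_add (L : E₁ × E₂ →ₗ[ℝ] E₁ × E₂) :
    LinearMap.trace ℝ _ L =
      LinearMap.trace ℝ E₁ (LinearMap.fst ℝ E₁ E₂ ∘ₗ L ∘ₗ LinearMap.inl ℝ E₁ E₂) +
      LinearMap.trace ℝ E₂ (LinearMap.snd ℝ E₁ E₂ ∘ₗ L ∘ₗ LinearMap.inr ℝ E₁ E₂) := by
  have h1 := LinearMap.trace_comp_comm' (LinearMap.inl ℝ E₁ E₂) (LinearMap.fst ℝ E₁ E₂ ∘ₗ L)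
  have h2 := LinearMap.trace_comp_comm' (LinearMap.inr ℝ E₁ E₂) (LinearMap.snd ℝ E₁ E₂ ∘ₗ L)
  rw [← LinearMap.comp_assoc, ← LinearMap.comp_assoc, h1, h2, ← map_add]
  congr 1
  ext <;> simp

end Trace

/-! ## The warped product in coordinates -/

section WarpedForm

variable {E₁ : Type*} [NormedAddCommGroup E₁] [NormedSpace ℝ E₁]
  {E₂ : Type*} [NormedAddCommGroup E₂] [NormedSpace ℝ E₂]

/-- The metric `a(ξ) g + b(ξ) h` on `E₁ × E₂`, where `g` is a constant metric on `E₁`, `ξ` a linear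
form on `E₁` and `h` a metric on `E₂`. -/
noncomputable def warpedForm (a b : ℝ → ℝ) (ξ : E₁ →L[ℝ] ℝ) (g : E₁ →L[ℝ] E₁ →L[ℝ] ℝ)
    (h : E₂ → E₂ →L[ℝ] E₂ →L[ℝ] ℝ) :
    E₁ × E₂ → (E₁ × E₂) →L[ℝ] (E₁ × E₂) →L[ℝ] ℝ := fun p =>
  a (ξ p.1) • ((ContinuousLinearMap.precomp ℝ (ContinuousLinearMap.fst ℝ E₁ E₂)) ∘L g ∘L
      ContinuousLinearMap.fst ℝ E₁ E₂) +
    b (ξ p.1) • ((ContinuousLinearMap.precomp ℝ (ContinuousLinearMap.snd ℝ E₁ E₂)) ∘L (h p.2) ∘L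
      ContinuousLinearMap.snd ℝ E₁ E₂)

variable {a b : ℝ → ℝ} {ξ : E₁ →L[ℝ] ℝ} {g : E₁ →L[ℝ] E₁ →L[ℝ] ℝ}
  {h : E₂ → E₂ →L[ℝ] E₂ →L[ℝ] ℝ}

theorem warpedForm_apply (p X Y : E₁ × E₂) :
    warpedForm a b ξ g h p X Y = a (ξ p.1) * g X.1 Y.1 + b (ξ p.1) * h p.2 X.2 Y.2 := rfl

theorem contDiffAt_warpedForm {k : WithTop ℕ∞} (ha : ContDiff ℝ k a) (hb : ContDiff ℝ k b)
    {p : E₁ × E₂} (hh : ContDiffAt ℝ k h p.2) : ContDiffAt ℝ k (warpedForm a b ξ g h) p := by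
  have h1 : ContDiffAt ℝ k (fun p : E₁ × E₂ => ξ p.1) p := by fun_prop
  have h2 : ContDiffAt ℝ k (fun p : E₁ × E₂ => h p.2) p := hh.comp p contDiffAt_snd
  refine ((ha.contDiffAt.comp p h1).smul contDiffAt_const).add
    ((hb.contDiffAt.comp p h1).smul ?_)
  exact contDiffAt_const.clm_comp (h2.clm_comp contDiffAt_const)

theorem warpedForm_nondegenerate {p : E₁ × E₂} (ha : a (ξ p.1) ≠ 0) (hb : b (ξ p.1) ≠ 0)
    (hg : ∀ v, (∀ w, g v w = 0) → v = 0) (hh : ∀ v, (∀ w, h p.2 v w = 0) → v = 0)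
    (X : E₁ × E₂) (hX : ∀ Y, warpedForm a b ξ g h p X Y = 0) : X = 0 := by
  refine Prod.ext (hg _ fun w => ?_) (hh _ fun w => ?_)
  · simpa [warpedForm_apply, ha] using hX (w, 0)
  · simpa [warpedForm_apply, hb] using hX (0, w)

theorem fderiv_warpedForm_apply {p : E₁ × E₂} {a' b' : ℝ} (ha : HasDerivAt a a' (ξ p.1))
    (hb : HasDerivAt b b' (ξ p.1)) (hh : DifferentiableAt ℝ h p.2)
    (hW : DifferentiableAt ℝ (warpedForm a b ξ g h) p) (X Y Z : E₁ × E₂) :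
    fderiv ℝ (warpedForm a b ξ g h) p X Y Z =
      a' * ξ X.1 * g Y.1 Z.1 + b' * ξ X.1 * h p.2 Y.2 Z.2
        + b (ξ p.1) * fderiv ℝ h p.2 X.2 Y.2 Z.2 := by
  rw [← fderiv_apply_apply hW]
  have hξ : HasFDerivAt (fun p : E₁ × E₂ => ξ p.1) (ξ ∘L ContinuousLinearMap.fst ℝ E₁ E₂) p :=
    ξ.hasFDerivAt.comp p hasFDerivAt_fst
  have hh' : HasFDerivAt (fun y => h y Y.2 Z.2) _ p.2 :=
    (hh.hasFDerivAt.clm_apply (hasFDerivAt_const Y.2 _)).clm_apply (hasFDerivAt_const Z.2 _)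
  have key := ((ha.comp_hasFDerivAt p hξ).mul_const (g Y.1 Z.1)).add
    ((hb.comp_hasFDerivAt p hξ).mul (hh'.comp p hasFDerivAt_snd))
  have e : (fun q => warpedForm a b ξ g h q Y Z) = fun q : E₁ × E₂ =>
    a (ξ q.1) * g Y.1 Z.1 + b (ξ q.1) * h q.2 Y.2 Z.2 := rfl
  rw [e]
  erw [key.fderiv]
  simp
  ring

variable [FiniteDimensional ℝ E₁] [FiniteDimensional ℝ E₂]

variable {p q r : ℝ → ℝ} {A : E₁} {U : Set E₂}

/-- The function `r = b q / a` arises from raising the index of `-b' ξ / 2` with the base metric `a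
g`. The formula is verified through the Koszul identity. -/
theorem christoffel_warpedForm (ha : ContDiff ℝ ∞ a) (hb : ContDiff ℝ ∞ b)
    (ha0 : ∀ t, a t ≠ 0) (hb0 : ∀ t, b t ≠ 0)
    (hap : ∀ t, deriv a t = 2 * a t * p t) (hbq : ∀ t, deriv b t = 2 * b t * q t)
    (hr : ∀ t, a t * r t = b t * q t)
    (hg : ∀ v, (∀ w, g v w = 0) → v = 0) (hA : ∀ v, g A v = ξ v)
    (hU : IsOpen U) (hh : ContDiffOn ℝ ∞ h U)
    (hhn : ∀ y ∈ U, ∀ v, (∀ w, h y v w = 0) → v = 0) {z : E₁ × E₂} (hz : z.2 ∈ U)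
    (X Y : E₁ × E₂) :
    christoffel (warpedForm a b ξ g h) z X Y =
      (p (ξ z.1) • (ξ X.1 • Y.1 + ξ Y.1 • X.1 - g X.1 Y.1 • A) - (r (ξ z.1) * h z.2 X.2 Y.2) • A,
        q (ξ z.1) • (ξ X.1 • Y.2 + ξ Y.1 • X.2) + christoffel h z.2 X.2 Y.2) := by
  have hhz : ContDiffAt ℝ ∞ h z.2 := hh.contDiffAt (hU.mem_nhds hz)
  have hWd : DifferentiableAt ℝ (warpedForm a b ξ g h) z :=
    (contDiffAt_warpedForm ha hb hhz).differentiableAt (by simp)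
  have hF := fderiv_warpedForm_apply ((ha.differentiable (by simp)) (ξ z.1)).hasDerivAt
    ((hb.differentiable (by simp)) (ξ z.1)).hasDerivAt (hhz.differentiableAt (by simp)) hWd
  refine christoffel_eq_of_forall (isInvertible_of_nondegenerate
    (warpedForm_nondegenerate (ha0 _) (hb0 _) hg (hhn _ hz))) fun Z => ?_
  have hc := two_mul_apply_christoffel (isInvertible_of_nondegenerate (hhn _ hz)) X.2 Y.2 Z.2
  rw [koszulForm_apply] at hc
  rw [koszulForm_apply, hF, hF, hF, warpedForm_apply, hap, hbq]
  simp only [map_add, map_sub, map_smul, add_apply,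
    sub_apply, smul_apply, smul_eq_mul, hA]
  have := hr (ξ z.1)
  linear_combination (-2 * h z.2 X.2 Y.2 * ξ Z.1) * this + b (ξ z.1) * hc

/-- The Ricci curvature of `a(ξ) g + b(ξ) h` when `ξ` is a null form, in terms of the logarithmic
derivatives `2 p = a' / a` and `2 q = b' / b`. -/
theorem coordRicci_warpedForm (ha : ContDiff ℝ ∞ a) (hb : ContDiff ℝ ∞ b)
    (ha0 : ∀ t, a t ≠ 0) (hb0 : ∀ t, b t ≠ 0)
    (hap : ∀ t, deriv a t = 2 * a t * p t) (hbq : ∀ t, deriv b t = 2 * b t * q t)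
    (hr : ∀ t, a t * r t = b t * q t)
    (hp' : Differentiable ℝ p) (hq' : Differentiable ℝ q) (hr' : Differentiable ℝ r)
    (hgs : ∀ v w, g v w = g w v) (hg : ∀ v, (∀ w, g v w = 0) → v = 0) (hA : ∀ v, g A v = ξ v)
    (hξA : ξ A = 0) (hU : IsOpen U) (hh : ContDiffOn ℝ ∞ h U)
    (hhs : ∀ y ∈ U, ∀ v w, h y v w = h y w v)
    (hhn : ∀ y ∈ U, ∀ v, (∀ w, h y v w = 0) → v = 0) {z : E₁ × E₂} (hz : z.2 ∈ U)
    (V W : E₁ × E₂) :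
    coordRicci (warpedForm a b ξ g h) z V W = coordRicci h z.2 V.2 W.2 +
      (((Module.finrank ℝ E₁ : ℝ) - 2) * (p (ξ z.1) ^ 2 - deriv p (ξ z.1))
        - (Module.finrank ℝ E₂ : ℝ) *
          (deriv q (ξ z.1) + q (ξ z.1) ^ 2 - 2 * p (ξ z.1) * q (ξ z.1))) *
        (ξ V.1 * ξ W.1) := by
  obtain ⟨x, y⟩ := z
  obtain ⟨v₁, v₂⟩ := V
  obtain ⟨w₁, w₂⟩ := W
  dsimp only at hz ⊢
  have hhy : ContDiffAt ℝ ∞ h y := hh.contDiffAt (hU.mem_nhds hz)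
  have hhd : DifferentiableAt ℝ h y := hhy.differentiableAt (by simp)
  have hΓ := fun z (hz : z.2 ∈ U) => christoffel_warpedForm (z := z) ha hb ha0 hb0 hap hbq hr hg hA
    hU hh hhn hz
  have hΓd : DifferentiableAt ℝ (christoffel (warpedForm a b ξ g h)) (x, y) :=
    differentiableAt_christoffel
      ((contDiffAt_warpedForm ha hb hhy).of_le
        (show ((2 : ℕ∞) : WithTop ℕ∞) ≤ ∞ from mod_cast le_top))
      (isInvertible_of_nondegenerate (warpedForm_nondegenerate (ha0 _) (hb0 _) hg (hhn _ hz)))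
  have hΓhd : DifferentiableAt ℝ (christoffel h) y :=
    differentiableAt_christoffel (hhy.of_le
        (show ((2 : ℕ∞) : WithTop ℕ∞) ≤ ∞ from mod_cast le_top))
      (isInvertible_of_nondegenerate (hhn _ hz))
  have hΓhs : ∀ v w, christoffel h y v w = christoffel h y w v :=
    christoffel_symm hhd ((hU.eventually_mem hz).mono hhs)
  have hξd : HasFDerivAt (fun p : E₁ × E₂ => ξ p.1) (ξ ∘L ContinuousLinearMap.fst ℝ E₁ E₂)
    (x, y) := ξ.hasFDerivAt.comp (x, y) hasFDerivAt_fst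
  have hDΓ : ∀ X Y Z : E₁ × E₂,
      fderiv ℝ (fun z => christoffel (warpedForm a b ξ g h) z X Y) (x, y) Z =
      ((deriv p (ξ x) * ξ Z.1) • (ξ X.1 • Y.1 + ξ Y.1 • X.1 - g X.1 Y.1 • A) -
        (deriv r (ξ x) * ξ Z.1 * h y X.2 Y.2 + r (ξ x) * fderiv ℝ h y Z.2 X.2 Y.2) • A,
      (deriv q (ξ x) * ξ Z.1) • (ξ X.1 • Y.2 + ξ Y.1 • X.2) +
        fderiv ℝ (fun y => christoffel h y X.2 Y.2) y Z.2) := by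
    intro X Y Z
    -- The explicit formula holds only over `U`, which is open, so it may be differentiated as a
    -- germ.
    have he : (fun z => christoffel (warpedForm a b ξ g h) z X Y) =ᶠ[nhds (x, y)] fun z =>
        (p (ξ z.1) • (ξ X.1 • Y.1 + ξ Y.1 • X.1 - g X.1 Y.1 • A) -
          (r (ξ z.1) * h z.2 X.2 Y.2) • A,
        q (ξ z.1) • (ξ X.1 • Y.2 + ξ Y.1 • X.2) + christoffel h z.2 X.2 Y.2) := by
      have : ∀ᶠ z : E₁ × E₂ in nhds (x, y), z.2 ∈ U :=
        continuousAt_snd.eventually (hU.eventually_mem hz)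
      exact this.mono fun z hz => hΓ z hz X Y
    rw [he.fderiv_eq]
    have hp1 := (hp' (ξ x)).hasDerivAt.comp_hasFDerivAt (x, y) hξd
    have hq1 := (hq' (ξ x)).hasDerivAt.comp_hasFDerivAt (x, y) hξd
    have hr1 := (hr' (ξ x)).hasDerivAt.comp_hasFDerivAt (x, y) hξd
    have hh1 : HasFDerivAt (fun z : E₁ × E₂ => h z.2 X.2 Y.2) _ (x, y) :=
      HasFDerivAt.comp (g := fun y => h y X.2 Y.2) (x, y)
        ((hhd.hasFDerivAt.clm_apply (hasFDerivAt_const X.2 _)).clm_apply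
          (hasFDerivAt_const Y.2 _)) hasFDerivAt_snd
    have hc1 : HasFDerivAt (fun z : E₁ × E₂ => christoffel h z.2 X.2 Y.2)
        (fderiv ℝ (fun y => christoffel h y X.2 Y.2) y ∘L ContinuousLinearMap.snd ℝ E₁ E₂)
        (x, y) :=
      HasFDerivAt.comp (g := fun y => christoffel h y X.2 Y.2) (x, y)
        (((hΓhd.clm_apply (differentiableAt_const X.2)).clm_apply
          (differentiableAt_const Y.2)).hasFDerivAt) hasFDerivAt_snd
    have key := ((hp1.smul_const (ξ X.1 • Y.1 + ξ Y.1 • X.1 - g X.1 Y.1 • A)).sub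
      ((hr1.mul hh1).smul_const A)).prodMk
      ((hq1.smul_const (ξ X.1 • Y.2 + ξ Y.1 • X.2)).add hc1)
    erw [key.fderiv]
    refine Prod.ext ?_ ?_
    · simp
      module
    · simp
  have hcurv := curvatureEnd_apply hΓd
  simp only [hDΓ, hΓ (x, y) hz] at hcurv
  have hgA : ∀ v, g v A = ξ v := fun v => by rw [hgs, hA]
  set P := p (ξ x)
  set Q := q (ξ x)
  set R := r (ξ x)
  set P' := deriv p (ξ x)
  set Q' := deriv q (ξ x)
  set R' := deriv r (ξ x)
  -- A multiple of the identity plus two rank-one maps. Each rank-one trace is `(P' - P²) ξ v₁ ξ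
  -- w₁`, which turns the dimension `n` of the base into `n - 2`; the fibre terms multiply `ξ A =
  -- 0`.
  have hblock₁ : LinearMap.fst ℝ E₁ E₂ ∘ₗ
      (curvatureEnd (warpedForm a b ξ g h) (x, y) (v₁, v₂) (w₁, w₂) :
        (E₁ × E₂) →ₗ[ℝ] (E₁ × E₂)) ∘ₗ LinearMap.inl ℝ E₁ E₂ =
      (ξ : E₁ →ₗ[ℝ] ℝ).smulRight
        ((P' * ξ w₁ - P ^ 2 * ξ w₁) • v₁
          - (P' * g v₁ w₁ - P ^ 2 * g v₁ w₁ + R' * h y v₂ w₂ - R * Q * h y v₂ w₂) • A)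
      + ((P ^ 2 - P') * (ξ v₁ * ξ w₁)) • LinearMap.id
      + (g ((P' * ξ v₁ - P ^ 2 * ξ v₁) • w₁) : E₁ →ₗ[ℝ] ℝ).smulRight A := by
    ext u
    simp [hcurv, hA, hgA, hξA, hgs u]
    match_scalars <;> ring
  -- The fibre curvature plus a multiple of the identity, whose trace brings in the factor `m`.
  have hblock₂ : LinearMap.snd ℝ E₁ E₂ ∘ₗ
      (curvatureEnd (warpedForm a b ξ g h) (x, y) (v₁, v₂) (w₁, w₂) :
        (E₁ × E₂) →ₗ[ℝ] (E₁ × E₂)) ∘ₗ LinearMap.inr ℝ E₁ E₂ =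
      (curvatureEnd h y v₂ w₂ : E₂ →ₗ[ℝ] E₂) +
        ((2 * P * Q - Q' - Q ^ 2) * (ξ v₁ * ξ w₁)) • LinearMap.id := by
    ext u
    simp [hcurv, hξA, curvatureEnd_apply hΓhd, hΓhs v₂ u]
    module
  unfold coordRicci
  rw [trace_prod_eq_add, hblock₁, hblock₂]
  simp only [map_add, map_smul, LinearMap.trace_smulRight, LinearMap.trace_id]
  simp [hξA, hgA]
  ring

end WarpedForm

/-! ### From the Ricci formula to the linear equation -/

section WarpedFunctions

variable {E₁ : Type*} [NormedAddCommGroup E₁] [NormedSpace ℝ E₁] [FiniteDimensional ℝ E₁]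
  {E₂ : Type*} [NormedAddCommGroup E₂] [NormedSpace ℝ E₂] [FiniteDimensional ℝ E₂]
  {ξ : E₁ →L[ℝ] ℝ} {g : E₁ →L[ℝ] E₁ →L[ℝ] ℝ} {h : E₂ → E₂ →L[ℝ] E₂ →L[ℝ] ℝ}

/-- The metric `φ(ξ)^{-2} g + f(ξ)^2 h` is Ricci-flat when `h` is and `(f, φ)` solves the linear
equation. -/
theorem coordRicci_warpedForm_eq_zero {f φ : ℝ → ℝ} (hf : ContDiff ℝ ∞ f) (hf0 : ∀ t, f t ≠ 0)
    (hφ : ContDiff ℝ ∞ φ) (hφ0 : ∀ t, φ t ≠ 0)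
    (hode : WarpingODE (Module.finrank ℝ E₁) (Module.finrank ℝ E₂) f φ)
    (hgs : ∀ v w, g v w = g w v) (hg : ∀ v, (∀ w, g v w = 0) → v = 0) {A : E₁}
    (hA : ∀ v, g A v = ξ v) (hξA : ξ A = 0) {U : Set E₂} (hU : IsOpen U)
    (hh : ContDiffOn ℝ ∞ h U) (hhs : ∀ y ∈ U, ∀ v w, h y v w = h y w v)
    (hhn : ∀ y ∈ U, ∀ v, (∀ w, h y v w = 0) → v = 0)
    (hRic : ∀ y ∈ U, ∀ v w, coordRicci h y v w = 0) {z : E₁ × E₂} (hz : z.2 ∈ U)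
    (V W : E₁ × E₂) :
    coordRicci (warpedForm (fun t => (φ t ^ 2)⁻¹) (fun t => f t ^ 2) ξ g h) z V W = 0 := by
  have hf' : ContDiff ℝ ∞ (deriv f) := (contDiff_infty_iff_deriv.1 hf).2
  have hφ' : ContDiff ℝ ∞ (deriv φ) := (contDiff_infty_iff_deriv.1 hφ).2
  have hfd : ∀ t, HasDerivAt f (deriv f t) t := fun t =>
    ((contDiff_infty_iff_deriv.1 hf).1 t).hasDerivAt
  have hfd' : ∀ t, HasDerivAt (deriv f) (deriv (deriv f) t) t := fun t =>
    ((contDiff_infty_iff_deriv.1 hf').1 t).hasDerivAt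
  have hφd : ∀ t, HasDerivAt φ (deriv φ t) t := fun t =>
    ((contDiff_infty_iff_deriv.1 hφ).1 t).hasDerivAt
  have hφd' : ∀ t, HasDerivAt (deriv φ) (deriv (deriv φ) t) t := fun t =>
    ((contDiff_infty_iff_deriv.1 hφ').1 t).hasDerivAt
  have hp : ∀ t, HasDerivAt (fun t => -(deriv φ t / φ t))
      (-((deriv (deriv φ) t * φ t - deriv φ t * deriv φ t) / φ t ^ 2)) t :=
    fun t => ((hφd' t).div (hφd t) (hφ0 t)).neg
  have hq : ∀ t, HasDerivAt (fun t => deriv f t / f t)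
      ((deriv (deriv f) t * f t - deriv f t * deriv f t) / f t ^ 2) t :=
    fun t => (hfd' t).div (hfd t) (hf0 t)
  rw [coordRicci_warpedForm (a := fun t => (φ t ^ 2)⁻¹) (p := fun t => -(deriv φ t / φ t))
    (q := fun t => deriv f t / f t) (r := fun t => f t * deriv f t * φ t ^ 2)
    (ContDiff.inv (f := fun t => φ t ^ 2) (hφ.pow 2) fun t => pow_ne_zero 2 (hφ0 t))
    (b := fun t => f t ^ 2) (hf.pow 2) (fun t => inv_ne_zero (pow_ne_zero 2 (hφ0 t))) (fun t => pow_ne_zero 2 (hf0 t))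
    ?_ ?_ ?_ (fun t => (hp t).differentiableAt) (fun t => (hq t).differentiableAt) ?_ hgs hg hA hξA
    hU hh hhs hhn hz, hRic _ hz, (hp _).deriv, (hq _).deriv, zero_add]
  · have hode := hode (ξ z.1)
    have h1 := hf0 (ξ z.1)
    have h2 := hφ0 (ξ z.1)
    -- Here `p² - p' = φ''/φ` and `q' + q² = f''/f`, so the bracket is the left side of the equation
    -- over `f φ`.
    refine mul_eq_zero_of_left ?_ _
    field_simp
    linear_combination f (ξ z.1) * φ (ξ z.1) * hode
  · intro t
    have := hφ0 t
    refine (((hφd t).pow 2).inv (pow_ne_zero 2 (hφ0 t))).deriv.trans ?_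
    simp only [Pi.pow_apply]
    push_cast
    field_simp
  · intro t
    have := hf0 t
    refine ((hfd t).pow 2).deriv.trans ?_
    push_cast
    field_simp
  · intro t
    have := hf0 t
    have := hφ0 t
    field_simp
  · exact ((hf.mul hf').mul (hφ.pow 2)).differentiable (by simp)

end WarpedFunctions

/-! ## Charts -/

section Charts

variable {n m : ℕ} {F : Type*} [TopologicalSpace F] [ChartedSpace (EuclideanSpace ℝ (Fin m)) F]

theorem pseudoEuclideanForm_apply (ε : Fin n → ℝ) (v w : EuclideanSpace ℝ (Fin n)) :
    pseudoEuclideanForm ε v w = ∑ i, ε i * (v i * w i) := by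
  simp [pseudoEuclideanForm]

theorem pseudoEuclideanForm_comm (ε : Fin n → ℝ) (v w : EuclideanSpace ℝ (Fin n)) :
    pseudoEuclideanForm ε v w = pseudoEuclideanForm ε w v := by
  simp [pseudoEuclideanForm_apply, mul_comm (v _)]

theorem pseudoEuclideanForm_nondegenerate {ε : Fin n → ℝ} (hε : ∀ i, ε i ≠ 0)
    (v : EuclideanSpace ℝ (Fin n)) (hv : ∀ w, pseudoEuclideanForm ε v w = 0) : v = 0 := by
  ext i
  have := hv (EuclideanSpace.single i 1)
  simpa [pseudoEuclideanForm_apply, hε i] using this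

/-- `xiFun` as a continuous linear form. -/
noncomputable def xiForm (α : Fin n → ℝ) : EuclideanSpace ℝ (Fin n) →L[ℝ] ℝ :=
  ∑ i, α i • (EuclideanSpace.proj i : EuclideanSpace ℝ (Fin n) →L[ℝ] ℝ)

theorem xiForm_apply (α : Fin n → ℝ) (x : EuclideanSpace ℝ (Fin n)) :
    xiForm α x = xiFun α x := by
  simp [xiForm, xiFun]

theorem mdifferentiableAt_extend_symm {E H M : Type*} [NormedAddCommGroup E] [NormedSpace ℝ E]
    [TopologicalSpace H] {I : ModelWithCorners ℝ E H} [I.Boundaryless] [TopologicalSpace M]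
    [ChartedSpace H M] [IsManifold I ∞ M] {e : OpenPartialHomeomorph M H} (he : e ∈ atlas H M)
    {y : E} (hy : y ∈ (e.extend I).target) :
    MDifferentiableAt 𝓘(ℝ, E) I (e.extend I).symm y := by
  have h := contMDiffOn_extend_symm (I := I) (n := ∞) (IsManifold.subset_maximalAtlas he)
  have ht : I '' e.target = (e.extend I).target := by
    rw [e.extend_target, I.image_eq]
  rw [ht] at h
  exact (h.contMDiffAt (e.isOpen_extend_target.mem_nhds hy)).mdifferentiableAt (by simp)

variable [IsManifold (𝓡 m) ∞ F]

/-- The differential of an inverse chart is bijective, so the pullback loses no test vectors. -/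
theorem coordMetric_nondegenerate {gF : BilinField (𝓡 m) F}
    (hgF : IsSemiRiemannianMetric (𝓡 m) gF)
    {e : OpenPartialHomeomorph F (EuclideanSpace ℝ (Fin m))}
    (he : e ∈ atlas (EuclideanSpace ℝ (Fin m)) F) {y : EuclideanSpace ℝ (Fin m)}
    (hy : y ∈ (e.extend (𝓡 m)).target) (v : EuclideanSpace ℝ (Fin m))
    (hv : ∀ w, coordMetric (𝓡 m) gF e y v w = 0) : v = 0 := by
  have : IsManifold (𝓡 m) 1 F := .of_le (n := ∞) (by simp)
  have hd := (mdifferentiable_of_mem_atlas (I := 𝓡 m) he).symm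
  have hy' : y ∈ e.symm.source := by simpa using hy
  have hb := hd.mfderiv_bijective hy'
  have hv' : mfderiv (𝓡 m) (𝓡 m) e.symm y v = 0 := by
    refine hgF.nondegenerate _ _ fun w => ?_
    obtain ⟨w, rfl⟩ := hb.2 w
    exact hv w
  exact hb.1 (hv'.trans (map_zero _).symm)

/-- Composed with the inverse of the chart `id × e`, the projections become `fst` and `e.symm ∘
snd`; the chain rule then identifies the two pulled-back summands. -/
theorem coordMetric_warpedXiMetric (ε α : Fin n → ℝ) (gF : BilinField (𝓡 m) F) (f φ : ℝ → ℝ)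
    {e : OpenPartialHomeomorph F (EuclideanSpace ℝ (Fin m))}
    (he : e ∈ atlas (EuclideanSpace ℝ (Fin m)) F)
    {z : EuclideanSpace ℝ (Fin n) × EuclideanSpace ℝ (Fin m)}
    (hz : z.2 ∈ (e.extend (𝓡 m)).target) :
    coordMetric ((𝓡 n).prod (𝓡 m)) (warpedXiMetric ε α gF f φ)
        ((OpenPartialHomeomorph.refl (EuclideanSpace ℝ (Fin n))).prod e) z =
      warpedForm (fun t => (φ t ^ 2)⁻¹) (fun t => f t ^ 2) (xiForm α) (pseudoEuclideanForm ε)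
        (coordMetric (𝓡 m) gF e) z := by
  set c := (OpenPartialHomeomorph.refl (EuclideanSpace ℝ (Fin n))).prod e with hc
  set s := (c.extend ((𝓡 n).prod (𝓡 m))).symm with hs
  have hcm : c ∈ atlas (ModelProd (EuclideanSpace ℝ (Fin n)) (EuclideanSpace ℝ (Fin m)))
      (EuclideanSpace ℝ (Fin n) × F) :=
    Set.mem_image2_of_mem rfl he
  have hzt : z ∈ (c.extend ((𝓡 n).prod (𝓡 m))).target := by
    simpa [hc] using hz
  have hsd := mdifferentiableAt_extend_symm hcm hzt
  have hed := mdifferentiableAt_extend_symm he hz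
  have h1 : ∀ X : EuclideanSpace ℝ (Fin n) × EuclideanSpace ℝ (Fin m),
      mfderiv ((𝓡 n).prod (𝓡 m)) (𝓡 n) Prod.fst (s z)
        (mfderiv 𝓘(ℝ, EuclideanSpace ℝ (Fin n) × EuclideanSpace ℝ (Fin m)) ((𝓡 n).prod (𝓡 m))
          s z X) = X.1 := by
    have h : mfderiv 𝓘(ℝ, EuclideanSpace ℝ (Fin n) × EuclideanSpace ℝ (Fin m)) (𝓡 n)
        (Prod.fst ∘ s) z =
          ContinuousLinearMap.fst ℝ (EuclideanSpace ℝ (Fin n)) (EuclideanSpace ℝ (Fin m)) :=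
      mfderiv_eq_fderiv.trans fderiv_fst
    exact fun X => congrArg
      (fun L : (EuclideanSpace ℝ (Fin n) × EuclideanSpace ℝ (Fin m)) →L[ℝ]
        EuclideanSpace ℝ (Fin n) => L X)
      ((mfderiv_comp z mdifferentiableAt_fst hsd).symm.trans h)
  have h2 : ∀ X : EuclideanSpace ℝ (Fin n) × EuclideanSpace ℝ (Fin m),
      mfderiv ((𝓡 n).prod (𝓡 m)) (𝓡 m) Prod.snd (s z)
        (mfderiv 𝓘(ℝ, EuclideanSpace ℝ (Fin n) × EuclideanSpace ℝ (Fin m)) ((𝓡 n).prod (𝓡 m))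
          s z X) = mfderiv (𝓡 m) (𝓡 m) (e.extend (𝓡 m)).symm z.2 X.2 := by
    have hsnd : MDifferentiableAt 𝓘(ℝ, EuclideanSpace ℝ (Fin n) × EuclideanSpace ℝ (Fin m)) (𝓡 m)
        (Prod.snd : EuclideanSpace ℝ (Fin n) × EuclideanSpace ℝ (Fin m) → _) z :=
      differentiableAt_snd.mdifferentiableAt
    have hd : mfderiv 𝓘(ℝ, EuclideanSpace ℝ (Fin n) × EuclideanSpace ℝ (Fin m)) (𝓡 m)
        Prod.snd z =
          ContinuousLinearMap.snd ℝ (EuclideanSpace ℝ (Fin n)) (EuclideanSpace ℝ (Fin m)) :=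
      mfderiv_eq_fderiv.trans fderiv_snd
    have h : mfderiv 𝓘(ℝ, EuclideanSpace ℝ (Fin n) × EuclideanSpace ℝ (Fin m)) (𝓡 m)
        (Prod.snd ∘ s) z = (mfderiv (𝓡 m) (𝓡 m) (e.extend (𝓡 m)).symm z.2).comp
          (ContinuousLinearMap.snd ℝ (EuclideanSpace ℝ (Fin n)) (EuclideanSpace ℝ (Fin m))) :=
      (mfderiv_comp z hed hsnd).trans (congrArg _ hd)
    exact fun X => congrArg
      (fun L : (EuclideanSpace ℝ (Fin n) × EuclideanSpace ℝ (Fin m)) →L[ℝ]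
        EuclideanSpace ℝ (Fin m) => L X)
      ((mfderiv_comp z mdifferentiableAt_snd hsd).symm.trans h)
  refine ContinuousLinearMap.ext fun X => ContinuousLinearMap.ext fun Y => ?_
  rw [warpedForm_apply, xiForm_apply]
  change (φ (xiFun α z.1) ^ 2)⁻¹ * pseudoEuclideanForm ε
      (mfderiv ((𝓡 n).prod (𝓡 m)) (𝓡 n) Prod.fst (s z) (mfderiv _ _ s z X))
      (mfderiv ((𝓡 n).prod (𝓡 m)) (𝓡 n) Prod.fst (s z) (mfderiv _ _ s z Y)) +
    f (xiFun α z.1) ^ 2 * gF ((e.extend (𝓡 m)).symm z.2)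
      (mfderiv ((𝓡 n).prod (𝓡 m)) (𝓡 m) Prod.snd (s z) (mfderiv _ _ s z X))
      (mfderiv ((𝓡 n).prod (𝓡 m)) (𝓡 m) Prod.snd (s z) (mfderiv _ _ s z Y)) = _
  erw [h1, h1, h2, h2]
  rfl

end Charts

theorem mem_target_extend_refl_prod {n m : ℕ} {F : Type*} [TopologicalSpace F]
    {e : OpenPartialHomeomorph F (EuclideanSpace ℝ (Fin m))}
    {z : EuclideanSpace ℝ (Fin n) × EuclideanSpace ℝ (Fin m)} :
    z ∈ (((OpenPartialHomeomorph.refl (EuclideanSpace ℝ (Fin n))).prod e).extend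
      ((𝓡 n).prod (𝓡 m))).target ↔ z.2 ∈ (e.extend (𝓡 m)).target := by
  simp

/-! ### The warped metric on the product manifold -/

section WarpedXiMetric

variable {n m : ℕ} {ε α : Fin n → ℝ} {F : Type*} [TopologicalSpace F]
  [ChartedSpace (EuclideanSpace ℝ (Fin m)) F] {gF : BilinField (𝓡 m) F} {f φ : ℝ → ℝ}

theorem warpedXiMetric_apply (p : EuclideanSpace ℝ (Fin n) × F)
    (X Y : EuclideanSpace ℝ (Fin n) × EuclideanSpace ℝ (Fin m)) :
    warpedXiMetric ε α gF f φ p X Y =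
      (φ (xiFun α p.1) ^ 2)⁻¹ * pseudoEuclideanForm ε X.1 Y.1 +
        f (xiFun α p.1) ^ 2 * (show EuclideanSpace ℝ (Fin m) →L[ℝ] EuclideanSpace ℝ (Fin m) →L[ℝ] ℝ
          from gF p.2) X.2 Y.2 := by
  change (φ (xiFun α p.1) ^ 2)⁻¹ * pseudoEuclideanForm ε
      (mfderiv ((𝓡 n).prod (𝓡 m)) (𝓡 n) Prod.fst p X)
      (mfderiv ((𝓡 n).prod (𝓡 m)) (𝓡 n) Prod.fst p Y) +
    f (xiFun α p.1) ^ 2 * gF p.2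
      (mfderiv ((𝓡 n).prod (𝓡 m)) (𝓡 m) Prod.snd p X)
      (mfderiv ((𝓡 n).prod (𝓡 m)) (𝓡 m) Prod.snd p Y) = _
  rw [mfderiv_fst, mfderiv_snd]
  rfl

/-- The atlas of the model space over itself contains only the identity, so charts `id × e` are all
there are. -/
theorem exists_eq_refl_prod_of_mem_atlas
    {e : OpenPartialHomeomorph (EuclideanSpace ℝ (Fin n) × F)
      (ModelProd (EuclideanSpace ℝ (Fin n)) (EuclideanSpace ℝ (Fin m)))}
    (he : e ∈ atlas (ModelProd (EuclideanSpace ℝ (Fin n)) (EuclideanSpace ℝ (Fin m)))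
      (EuclideanSpace ℝ (Fin n) × F)) :
    ∃ e' ∈ atlas (EuclideanSpace ℝ (Fin m)) F,
      e = (OpenPartialHomeomorph.refl (EuclideanSpace ℝ (Fin n))).prod e' := by
  obtain ⟨e₁, he₁, e', he', rfl⟩ := he
  rw [chartedSpaceSelf_atlas] at he₁
  exact ⟨e', he', by rw [he₁]⟩

/-- On a pair of fibre vectors with nonzero `gF`-product the metric recovers `c²`, hence `c > 0`.
Such a pair exists because `F` has a point, `m ≥ 1` and `gF` is nondegenerate. -/
theorem warpedXiMetric_const_mul_injOn [Nonempty F] (hm : 1 ≤ m)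
    (hgF : IsSemiRiemannianMetric (𝓡 m) gF) (hf0 : ∀ t, f t ≠ 0) :
    Set.InjOn (fun c : ℝ => warpedXiMetric ε α gF (fun t => c * f t) φ) (Set.Ioi 0) := by
  intro c hc d hd hcd
  obtain ⟨y⟩ := ‹Nonempty F›
  have : Nonempty (Fin m) := ⟨⟨0, hm⟩⟩
  obtain ⟨v, hv⟩ := exists_ne (0 : EuclideanSpace ℝ (Fin m))
  obtain ⟨w, hw⟩ : ∃ w : EuclideanSpace ℝ (Fin m), (show EuclideanSpace ℝ (Fin m) →L[ℝ]
      EuclideanSpace ℝ (Fin m) →L[ℝ] ℝ from gF y) v w ≠ 0 := by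
    by_contra! h
    exact hv (hgF.nondegenerate y v h)
  have key := congrArg (fun G : BilinField ((𝓡 n).prod (𝓡 m)) (EuclideanSpace ℝ (Fin n) × F) =>
    (show (EuclideanSpace ℝ (Fin n) × EuclideanSpace ℝ (Fin m)) →L[ℝ]
      (EuclideanSpace ℝ (Fin n) × EuclideanSpace ℝ (Fin m)) →L[ℝ] ℝ from G (0, y))
        (0, v) (0, w)) hcd
  have key' := (warpedXiMetric_apply (0, y) (0, v) (0, w)).symm.trans
    (key.trans (warpedXiMetric_apply (0, y) (0, v) (0, w)))
  simp only [map_zero, mul_zero, zero_add] at key'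
  have h2 := mul_right_cancel₀ hw key'
  rw [mul_pow, mul_pow] at h2
  have h3 := mul_right_cancel₀ (pow_ne_zero 2 (hf0 _)) h2
  exact (pow_left_inj₀ (le_of_lt hc) (le_of_lt hd) two_ne_zero).1 h3

variable [IsManifold (𝓡 m) ∞ F]

theorem isSemiRiemannianMetric_warpedXiMetric (hε : ∀ i, ε i ≠ 0)
    (hgF : IsSemiRiemannianMetric (𝓡 m) gF) (hf : ContDiff ℝ ∞ f) (hf0 : ∀ t, f t ≠ 0)
    (hφ : ContDiff ℝ ∞ φ) (hφ0 : ∀ t, φ t ≠ 0) :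
    IsSemiRiemannianMetric ((𝓡 n).prod (𝓡 m)) (warpedXiMetric ε α gF f φ) where
  symm p X Y := by
    refine (warpedXiMetric_apply p X Y).trans
      (Eq.trans ?_ (warpedXiMetric_apply p Y X).symm)
    rw [pseudoEuclideanForm_comm]
    congr 2
    exact hgF.symm _ _ _
  nondegenerate p X hX := by
    have hX' : ∀ Y : EuclideanSpace ℝ (Fin n) × EuclideanSpace ℝ (Fin m), _ = (0 : ℝ) :=
      fun Y => (warpedXiMetric_apply p X Y).symm.trans (hX Y)
    refine Prod.ext (pseudoEuclideanForm_nondegenerate hε _ fun w => ?_)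
      (hgF.nondegenerate p.2 _ fun w => ?_)
    · simpa [hφ0] using hX' (w, 0)
    · have h := hX' (0, w)
      simp only [map_zero, mul_zero, zero_add] at h
      exact (mul_eq_zero.1 h).resolve_left (pow_ne_zero 2 (hf0 _))
  smooth e he := by
    obtain ⟨e, he', rfl⟩ := exists_eq_refl_prod_of_mem_atlas he
    intro z hz
    rw [mem_target_extend_refl_prod] at hz
    refine ContDiffWithinAt.congr (f := warpedForm (fun t => (φ t ^ 2)⁻¹) (fun t => f t ^ 2)
      (xiForm α) (pseudoEuclideanForm ε) (coordMetric (𝓡 m) gF e)) ?_ (fun z hz => ?_) ?_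
    · exact (contDiffAt_warpedForm
        (ContDiff.inv (f := fun t => φ t ^ 2) (hφ.pow 2) fun t => pow_ne_zero 2 (hφ0 t))
        (hf.pow 2) ((hgF.smooth e he').contDiffAt
          (e.isOpen_extend_target.mem_nhds hz))).contDiffWithinAt
    · exact coordMetric_warpedXiMetric ε α gF f φ he' (mem_target_extend_refl_prod.1 hz)
    · exact coordMetric_warpedXiMetric ε α gF f φ he' hz

theorem isRicciFlat_warpedXiMetric (hε : ∀ i, ε i = 1 ∨ ε i = -1)
    (hα : ∑ i, ε i * α i ^ 2 = 0) (hgF : IsSemiRiemannianMetric (𝓡 m) gF)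
    (hRic : IsRicciFlat (𝓡 m) gF) (hf : ContDiff ℝ ∞ f) (hf0 : ∀ t, f t ≠ 0)
    (hφ : ContDiff ℝ ∞ φ) (hφ0 : ∀ t, φ t ≠ 0) (hode : WarpingODE n m f φ) :
    IsRicciFlat ((𝓡 n).prod (𝓡 m)) (warpedXiMetric ε α gF f φ) := by
  intro e he z hz V W
  obtain ⟨e, he', rfl⟩ := exists_eq_refl_prod_of_mem_atlas he
  rw [mem_target_extend_refl_prod] at hz
  have hε2 : ∀ i, ε i * ε i = 1 := fun i => by rcases hε i with h | h <;> simp [h]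
  have hε0 : ∀ i, ε i ≠ 0 := fun i h => by simpa [h] using hε2 i
  have hev : coordMetric ((𝓡 n).prod (𝓡 m)) (warpedXiMetric ε α gF f φ)
        ((OpenPartialHomeomorph.refl (EuclideanSpace ℝ (Fin n))).prod e) =ᶠ[nhds z]
      warpedForm (fun t => (φ t ^ 2)⁻¹) (fun t => f t ^ 2) (xiForm α) (pseudoEuclideanForm ε)
        (coordMetric (𝓡 m) gF e) :=
    (continuousAt_snd.eventually (e.isOpen_extend_target.eventually_mem hz)).mono
      fun z hz => coordMetric_warpedXiMetric ε α gF f φ he' hz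
  rw [coordRicci_congr hev]
  refine coordRicci_warpedForm_eq_zero hf hf0 hφ hφ0 (by simpa using hode)
    (pseudoEuclideanForm_comm ε) (pseudoEuclideanForm_nondegenerate hε0)
    -- The gradient of `ξ`: the index of `α` is raised using `ε i ^ 2 = 1`, and `ξ A` is the sum in
    -- `hα`.
    (A := WithLp.toLp 2 fun i => ε i * α i) (fun v => ?_) ?_ e.isOpen_extend_target
    (hgF.smooth e he') (fun y _ v w => hgF.symm _ _ _)
    (fun y hy => coordMetric_nondegenerate hgF he' hy) (hRic e he') hz V W
  · rw [pseudoEuclideanForm_apply, xiForm_apply, xiFun]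
    refine Finset.sum_congr rfl fun i _ => ?_
    change ε i * (ε i * α i * v i) = _
    linear_combination α i * v i * hε2 i
  · rw [xiForm_apply, xiFun, ← hα]
    refine Finset.sum_congr rfl fun i _ => ?_
    change α i * (ε i * α i) = _
    ring

theorem WarpingODE.const_mul (h : WarpingODE n m f φ) (c : ℝ) :
    WarpingODE n m (fun t => c * f t) φ := by
  intro t
  have h1 : deriv (fun t => c * f t) = fun t => c * deriv f t :=
    funext fun t => deriv_const_mul_field c
  rw [h1, deriv_const_mul_field]
  linear_combination c * h t

end WarpedXiMetric

/-! ### The main theorem -/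

theorem theorem1p5 {n m : ℕ} (hn : 3 ≤ n) (hm : 1 ≤ m)
    (ε : Fin n → ℝ) (hε : ∀ i, ε i = 1 ∨ ε i = -1)
    (α : Fin n → ℝ) (hα : ∑ i, ε i * α i ^ 2 = 0)
    {F : Type*} [TopologicalSpace F] [Nonempty F] [ChartedSpace (EuclideanSpace ℝ (Fin m)) F]
    [IsManifold (𝓡 m) ∞ F]
    (gF : BilinField (𝓡 m) F) (hgF : IsSemiRiemannianMetric (𝓡 m) gF)
    (hRic : IsRicciFlat (𝓡 m) gF) :
    (∀ f : ℝ → ℝ, ContDiff ℝ ∞ f → (∀ t, 0 < f t) →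
      (∃ φ : ℝ → ℝ, ContDiff ℝ ∞ φ ∧ (∀ t, 0 < φ t) ∧ WarpingODE n m f φ) ∧
      (∀ φ : ℝ → ℝ, ContDiff ℝ ∞ φ → (∀ t, φ t ≠ 0) → WarpingODE n m f φ →
        IsSemiRiemannianMetric ((𝓡 n).prod (𝓡 m)) (warpedXiMetric ε α gF f φ) ∧
        IsRicciFlat ((𝓡 n).prod (𝓡 m)) (warpedXiMetric ε α gF f φ))) ∧
    {G : BilinField ((𝓡 n).prod (𝓡 m)) (EuclideanSpace ℝ (Fin n) × F) |
      ∃ f φ : ℝ → ℝ, ContDiff ℝ ∞ f ∧ (∀ t, 0 < f t) ∧ ContDiff ℝ ∞ φ ∧ (∀ t, 0 < φ t) ∧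
        WarpingODE n m f φ ∧ G = warpedXiMetric ε α gF f φ ∧
        IsSemiRiemannianMetric ((𝓡 n).prod (𝓡 m)) G ∧
        IsRicciFlat ((𝓡 n).prod (𝓡 m)) G}.Infinite := by

  have hε0 : ∀ i, ε i ≠ 0 := fun i h => by rcases hε i with h' | h' <;> norm_num [h'] at h
  have hmetric : ∀ f φ : ℝ → ℝ, ContDiff ℝ ∞ f → (∀ t, 0 < f t) → ContDiff ℝ ∞ φ →
      (∀ t, φ t ≠ 0) → WarpingODE n m f φ →
      IsSemiRiemannianMetric ((𝓡 n).prod (𝓡 m)) (warpedXiMetric ε α gF f φ) ∧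
        IsRicciFlat ((𝓡 n).prod (𝓡 m)) (warpedXiMetric ε α gF f φ) :=
    fun f φ hf hf0 hφ hφ0 hode =>
      ⟨isSemiRiemannianMetric_warpedXiMetric hε0 hgF hf (fun t => (hf0 t).ne') hφ hφ0,
        isRicciFlat_warpedXiMetric hε hα hgF hRic hf (fun t => (hf0 t).ne') hφ hφ0 hode⟩
  refine ⟨fun f hf hf0 => ⟨exists_pos_warpingODE hn hf hf0,
    fun φ hφ hφ0 hode => hmetric f φ hf hf0 hφ hφ0 hode⟩, ?_⟩
  -- Any positive smooth function could replace `exp`; a single `φ` serves all the multiples `c *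
  -- exp`.
  obtain ⟨φ, hφ, hφ0, hode⟩ := exists_pos_warpingODE (m := m) hn Real.contDiff_exp Real.exp_pos
  refine ((Set.Ioi_infinite (0 : ℝ)).image (warpedXiMetric_const_mul_injOn (ε := ε) (α := α)
    (φ := φ) hm hgF (fun t => (Real.exp_pos t).ne'))).mono ?_
  rintro _ ⟨c, hc, rfl⟩
  have hf : ContDiff ℝ ∞ fun t => c * Real.exp t := contDiff_const.mul Real.contDiff_exp
  have hf0 : ∀ t, 0 < c * Real.exp t := fun t => mul_pos hc (Real.exp_pos t)
  exact ⟨_, φ, hf, hf0, hφ, hφ0, hode.const_mul c, rfl,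
    hmetric _ φ hf hf0 hφ (fun t => (hφ0 t).ne') (hode.const_mul c)⟩
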